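/- Let $\Lambda\subset\mathbb{C}$ be any lattice (the $\mathbb{Z}$-span of two $\mathbb{R}$-linearly independent complex numbers), and let $\wp$ be the Weierstrass $\wp$-function with period lattice $\Lambda$. By a solution of the equation $$\wp'(\wp(z)^2)=z \qquad (*)$$ we mean a $z\in\mathbb{C}$ such that $z$ is not a pole of $\wp$, $\wp(z)^2$ is not a pole of $\wp'$, and $(*)$ holds. Then $(*)$ has a solution. Indeed, there is an $R\in\mathbb{R}$, and there are 12 infinite families of solutions $S_1,\dots,S_{12}$ of $(*)$ parametrised by the pairs $\omega=(\omega_1,\omega_2)\in\Lambda^2$ with $|\omega_1|,|\omega_2|>R$, in the following sense: 1. for each $i$ and each such $\omega$, the number $S_i(\omega)$ is a solution of $(*)$; 2. for each $i$, the set of values of $S_i$ is infinite, and all the solutions $S_i(\omega)$ are distinct: $S_i(\omega)=S_j(\eta)$ only if $i=j$ and $\omega=\eta$; 3. $S_i(\omega)-\omega_1\to 0$ and $\wp(S_i(\omega))^2-\omega_2\to 0$ for each $i$, as $|\omega_1|$ and $|\omega_2|$ both tend to infinity; 4. there is an $R_2\in\mathbb{R}$ such that every solution $z$ of $(*)$ with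 $|z|>R_2$ and $|\wp(z)|^2>R_2$ is one of the $S_i(\omega)$. -/

import Mathlib

/-- `z` is a solution of `℘'(℘(z)²) = z` for the Weierstrass function `℘` of the period lattice of
`L`. Both sides have to make sense in `ℂ`: `z` is not a pole of `℘` and `℘(z)²` is not a pole of
`℘'`, the poles of `℘` and of `℘'` being exactly the lattice points. (Mathlib's functions take the
value `0` at their poles.) -/
def IsWeierstrassSolution (L : PeriodPair) (z : ℂ) : Prop :=
  z ∉ L.lattice ∧ L.weierstrassP z ^ 2 ∉ L.lattice ∧
    L.derivWeierstrassP (L.weierstrassP z ^ 2) = z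

/-- The pairs of periods `(ω₁, ω₂) ∈ Λ²` with `|ω₁| > R` and `|ω₂| > R`. -/
def largePeriodPairs (L : PeriodPair) (R : ℝ) : Set (L.lattice × L.lattice) :=
  {ω | R < ‖(ω.1 : ℂ)‖ ∧ R < ‖(ω.2 : ℂ)‖}

/-! Write `z = ω₁ + s` and `℘(z)² = ω₂ + t` with `s`, `t` small. By periodicity the equation becomes
the system `℘(s)² = ω₂ + t`, `℘'(t) = ω₁ + s`. At `0` the function `℘²` has a pole of order 4 and
`℘'` one of order 3, so for large periods the two equations amount to `s = T k t` and `t = U j s`,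
with 4 and 3 contracting branches (`exists_poleBranches`). Each of the 12 choices of `(k, j)` has
exactly one solution, by the contraction principle. No large solution is missed, because a periodic
function is large only near the lattice (`PeriodPair.exists_mem_lattice_of_lt_norm`). -/

/-! ### Branches of the inverse near a pole. -/

open Metric Set Filter Topology in
/-- If `f` has a pole of order `n` at `0`, then `f = φ⁻ⁿ` near `0` for a local coordinate `φ`. -/
theorem exists_localCoordinate_of_pole {f h : ℂ → ℂ} {n : ℕ} (hn : n ≠ 0)
    (hh : AnalyticAt ℂ h 0) (h0 : h 0 ≠ 0) (hf : ∀ᶠ s in 𝓝 (0 : ℂ), s ≠ 0 → f s = h s / s ^ n) :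
    ∃ (φ Φ : ℂ → ℂ) (r δ : ℝ) (K : NNReal), 0 < r ∧ 0 < δ ∧ φ 0 = 0 ∧
      (∀ s ∈ closedBall (0 : ℂ) δ, Φ (φ s) = s) ∧
      (∀ x ∈ closedBall (0 : ℂ) r, φ (Φ x) = x) ∧
      (∀ s ∈ closedBall (0 : ℂ) δ, s ≠ 0 → f s = (φ s ^ n)⁻¹) ∧
      LipschitzOnWith K Φ (closedBall 0 r) := by
  -- An `n`-th root of `h`; dividing by `h 0` puts the base near `1`, where the principal power is
  -- analytic.
  set g : ℂ → ℂ := fun s ↦ h 0 ^ ((n : ℂ)⁻¹) * (h s / h 0) ^ ((n : ℂ)⁻¹) with hg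
  have hgn : ∀ s, g s ^ n = h s := fun s ↦ by
    simp only [hg, mul_pow, Complex.cpow_nat_inv_pow _ hn]
    field_simp
  have hg0 : g 0 ≠ 0 := fun H ↦ h0 (by rw [← hgn, H, zero_pow hn])
  have hga : AnalyticAt ℂ g 0 :=
    analyticAt_const.mul ((hh.div analyticAt_const h0).cpow analyticAt_const (by simp [h0]))
  set φ : ℂ → ℂ := fun s ↦ s / g s with hφ
  have hφ0 : φ 0 = 0 := by simp [hφ]
  have hd : HasStrictDerivAt φ ((g 0)⁻¹) 0 := by
    have h1 := (hasStrictDerivAt_id (0 : ℂ)).div hga.hasStrictDerivAt hg0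
    refine h1.congr_deriv ?_
    simp
    field_simp
  have hd0 : (g 0)⁻¹ ≠ 0 := inv_ne_zero hg0
  set Φ := hd.localInverse φ _ 0 hd0
  have hl : ∀ᶠ s in 𝓝 (0 : ℂ), Φ (φ s) = s := HasStrictFDerivAt.eventually_left_inverse _
  have hr : ∀ᶠ x in 𝓝 (φ 0), φ (Φ x) = x := HasStrictFDerivAt.eventually_right_inverse _
  have hΦ := hd.to_localInverse hd0
  obtain ⟨K, u, hu, hK⟩ := hΦ.hasStrictFDerivAt.exists_lipschitzOnWith
  rw [hφ0] at hr hu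
  obtain ⟨r, hr0, hrs⟩ := nhds_basis_closedBall.mem_iff.mp (inter_mem hr hu)
  obtain ⟨δ, hδ0, hδs⟩ := nhds_basis_closedBall.mem_iff.mp (inter_mem hl hf)
  refine ⟨φ, Φ, r, δ, K, hr0, hδ0, hφ0, fun s hs ↦ (hδs hs).1, fun x hx ↦ (hrs hx).1,
    fun s hs hs0 ↦ ?_, hK.mono fun x hx ↦ (hrs hx).2⟩
  rw [(hδs hs).2 hs0, hφ, div_pow, hgn, inv_div]

-- Controls the factor `(1 + t / ω)^(-1/n)` of `(ω + t)^(-1/n)`. Its value at `0` is `1`, so `2`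
-- bounds it nearby.
open Metric Set Filter Topology in
theorem exists_lipschitzOnWith_inv_root (n : ℕ) :
    ∃ (r : ℝ) (K : NNReal), 0 < r ∧
      LipschitzOnWith K (fun x : ℂ ↦ ((1 + x) ^ ((n : ℂ)⁻¹))⁻¹) (closedBall 0 r) ∧
      ∀ x ∈ closedBall (0 : ℂ) r, ‖((1 + x) ^ ((n : ℂ)⁻¹))⁻¹‖ ≤ 2 := by
  have ha : AnalyticAt ℂ (fun x : ℂ ↦ ((1 + x) ^ ((n : ℂ)⁻¹))⁻¹) 0 :=
    ((analyticAt_const.add analyticAt_id).cpow analyticAt_const (by simp)).inv (by simp)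
  obtain ⟨K, u, hu, hK⟩ := ha.hasStrictDerivAt.hasStrictFDerivAt.exists_lipschitzOnWith
  have hb : ∀ᶠ x in 𝓝 (0 : ℂ), ‖((1 + x) ^ ((n : ℂ)⁻¹))⁻¹‖ < 2 :=
    ha.continuousAt.norm.eventually_lt continuousAt_const (by simp)
  obtain ⟨r, hr0, hrs⟩ := nhds_basis_closedBall.mem_iff.mp (inter_mem hb hu)
  exact ⟨r, K, hr0, hK.mono fun x hx ↦ (hrs hx).2, fun x hx ↦ (hrs hx).1.le⟩

open Metric Set in
/-- The functions `T k` are `n` distinct contractions of a small closed ball about `0`, with values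
of absolute value at most `δ`, which together describe all the small solutions `s ≠ 0` of
`f s = ω + t`. -/
structure PoleBranches (f : ℂ → ℂ) {n : ℕ} (T : Fin n → ℂ → ℂ) (ω : ℂ) (δ₀ δ : ℝ) : Prop where
  mapsTo : ∀ k, MapsTo (T k) (closedBall 0 δ₀) (closedBall 0 δ)
  lipschitz : ∀ k, LipschitzOnWith (1 / 2) (T k) (closedBall 0 δ₀)
  injective : ∀ t ∈ closedBall (0 : ℂ) δ₀, Function.Injective fun k ↦ T k t
  solves : ∀ s ∈ closedBall (0 : ℂ) δ₀, ∀ t ∈ closedBall (0 : ℂ) δ₀,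
    (s ≠ 0 ∧ f s = ω + t) ↔ ∃ k, s = T k t

open Metric Set in
theorem PoleBranches.mono {f : ℂ → ℂ} {n : ℕ} {T : Fin n → ℂ → ℂ} {ω : ℂ} {δ₀ δ₁ δ : ℝ}
    (h : PoleBranches f T ω δ₀ δ) (h1 : δ₁ ≤ δ₀) : PoleBranches f T ω δ₁ δ where
  mapsTo k := (h.mapsTo k).mono_left (closedBall_subset_closedBall h1)
  lipschitz k := (h.lipschitz k).mono (closedBall_subset_closedBall h1)
  injective t ht := h.injective t (closedBall_subset_closedBall h1 ht)
  solves s hs t ht := h.solves s (closedBall_subset_closedBall h1 hs) t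
    (closedBall_subset_closedBall h1 ht)

open Metric Set Filter Topology in
/-- Near a pole of order `n` of `f`, the equation `f s = ω + t` is solved by `n` branches, which
tend to the pole as `ω` tends to infinity. -/
theorem exists_poleBranches {f h : ℂ → ℂ} {n : ℕ} (hn : n ≠ 0)
    (hh : AnalyticAt ℂ h 0) (h0 : h 0 ≠ 0) (hf : ∀ᶠ s in 𝓝 (0 : ℂ), s ≠ 0 → f s = h s / s ^ n) :
    ∃ (T : ℂ → Fin n → ℂ → ℂ) (δ₀ : ℝ), 0 < δ₀ ∧ ∀ δ, 0 < δ → δ ≤ δ₀ → ∃ R : ℝ,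
      ∀ ω : ℂ, R < ‖ω‖ → PoleBranches f (T ω) ω δ₀ δ := by
  obtain ⟨φ, Φ, r, δ₁, K, hr, hδ₁, hφ0, hl, hri, hφf, hK⟩ :=
    exists_localCoordinate_of_pole hn hh h0 hf
  obtain ⟨r', K', hr', hK', hp⟩ := exists_lipschitzOnWith_inv_root n
  set p : ℂ → ℂ := fun x ↦ ((1 + x) ^ ((n : ℂ)⁻¹))⁻¹ with hpdef
  have hpn : ∀ x, p x ^ n = (1 + x)⁻¹ := fun x ↦ by
    simp only [hpdef, inv_pow, Complex.cpow_nat_inv_pow _ hn]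
  set a : ℂ → ℂ := fun ω ↦ (ω⁻¹) ^ ((n : ℂ)⁻¹) with hadef
  have han : ∀ ω, a ω ^ n = ω⁻¹ := fun ω ↦ Complex.cpow_nat_inv_pow _ hn
  set ζ : ℂ := Complex.exp (2 * Real.pi * Complex.I / n) with hζdef
  have hζ : IsPrimitiveRoot ζ n := Complex.isPrimitiveRoot_exp n hn
  have hζ1 : ∀ k : ℕ, ‖ζ ^ k‖ = 1 := fun k ↦ by rw [norm_pow, hζ.norm'_eq_one hn, one_pow]
  have hΦ0 : Φ 0 = 0 := by simpa [hφ0] using hl 0 (by simp [hδ₁.le])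
  have hΦn : ∀ x ∈ closedBall (0 : ℂ) r, ‖Φ x‖ ≤ K * ‖x‖ := fun x hx ↦ by
    simpa [hΦ0, dist_eq_norm] using hK.dist_le_mul x hx 0 (by simp [hr.le])
  -- In the coordinate `φ` the equation reads `φ ^ (-n) = ω + t`, whose roots are `ζ^k ω^(-1/n) (1 +
  -- t/ω)^(-1/n)`. The cap `1 / 2` keeps `ω + t ≠ 0` once `‖ω‖ > 1`.
  refine ⟨fun ω k t ↦ Φ (ζ ^ (k : ℕ) * a ω * p (t / ω)), min (1 / 2) (min δ₁ r'), by positivity,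
    fun δ hδ hδle ↦ ?_⟩
  set δ₀ := min (1 / 2) (min δ₁ r') with hδ₀
  have hδ₀1 : δ₀ ≤ 1 / 2 := min_le_left _ _
  have hδ₀δ₁ : δ₀ ≤ δ₁ := (min_le_right _ _).trans (min_le_left _ _)
  have hδ₀r' : δ₀ ≤ r' := (min_le_right _ _).trans (min_le_right _ _)
  -- `η` will bound `‖ω^(-1/n)‖`: the conditions keep the roots in the domain of `Φ`, their images
  -- within `δ`, and the Lipschitz constant at most `1 / 2`.
  obtain ⟨η, hη, hη1, hη2, hη3⟩ : ∃ η : ℝ, 0 < η ∧ η * 2 ≤ r ∧ K * (η * 2) ≤ δ ∧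
      K * (η * K') ≤ 1 / 2 := by
    have e : ∀ (c b : ℝ), 0 < b → ∀ᶠ η in 𝓝[>] (0 : ℝ), c * η ≤ b := fun c b hb ↦ by
      have : Tendsto (fun η : ℝ ↦ c * η) (𝓝[>] 0) (𝓝 0) := by
        simpa using (tendsto_id.const_mul c).mono_left (nhdsWithin_le_nhds (a := (0 : ℝ)))
      exact this.eventually_le_const hb
    obtain ⟨η, h1, h2, h3, h4⟩ := (eventually_mem_nhdsWithin.and ((e 2 r hr).and
      ((e (K * 2) δ hδ).and (e (K * K') (1 / 2) (by norm_num))))).exists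
    exact ⟨η, h1, by linarith, by linarith, by linarith⟩
  refine ⟨max 1 ((η ^ n)⁻¹), fun ω hω ↦ ?_⟩
  have hω1 : 1 < ‖ω‖ := (le_max_left _ _).trans_lt hω
  have hω0 : ω ≠ 0 := norm_pos_iff.mp (by linarith)
  have haη : ‖a ω‖ ≤ η := by
    refine le_of_lt (lt_of_pow_lt_pow_left₀ n hη.le ?_)
    rw [← norm_pow, han, norm_inv]
    exact inv_lt_of_inv_lt₀ (by positivity) ((le_max_right _ _).trans_lt hω)
  have ha0 : a ω ≠ 0 := fun H ↦ by
    have := han ω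
    rw [H, zero_pow hn] at this
    exact inv_ne_zero hω0 this.symm
  have hdiv : ∀ t ∈ closedBall (0 : ℂ) δ₀, t / ω ∈ closedBall (0 : ℂ) r' := fun t ht ↦ by
    rw [mem_closedBall_zero_iff] at ht ⊢
    rw [norm_div]
    exact (div_le_self (norm_nonneg _) hω1.le).trans (ht.trans hδ₀r')
  have hne : ∀ t ∈ closedBall (0 : ℂ) δ₀, ω + t ≠ 0 := fun t ht H ↦ by
    rw [mem_closedBall_zero_iff] at ht
    rw [eq_neg_of_add_eq_zero_left H, norm_neg] at hω1
    linarith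
  have hfac : ∀ t, ω + t = ω * (1 + t / ω) := fun t ↦ by field_simp
  have hp0 : ∀ t ∈ closedBall (0 : ℂ) δ₀, p (t / ω) ≠ 0 := fun t ht H ↦ by
    have h1 := hpn (t / ω)
    rw [H, zero_pow hn] at h1
    exact hne t ht (by rw [hfac, inv_eq_zero.mp h1.symm, mul_zero])
  have harg : ∀ k : ℕ, ∀ t ∈ closedBall (0 : ℂ) δ₀, ‖ζ ^ k * a ω * p (t / ω)‖ ≤ η * 2 :=
    fun k t ht ↦ by
      rw [norm_mul, norm_mul, hζ1, one_mul]
      exact mul_le_mul haη (hp _ (hdiv t ht)) (norm_nonneg _) hη.le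
  have hargr : ∀ k : ℕ, ∀ t ∈ closedBall (0 : ℂ) δ₀,
      ζ ^ k * a ω * p (t / ω) ∈ closedBall (0 : ℂ) r := fun k t ht ↦
    mem_closedBall_zero_iff.mpr ((harg k t ht).trans hη1)
  have hpow : ∀ k : ℕ, ∀ t, ((ζ ^ k * a ω * p (t / ω)) ^ n)⁻¹ = ω + t := fun k t ↦ by
    rw [mul_pow, mul_pow, ← pow_mul, mul_comm k, pow_mul, hζ.pow_eq_one, one_pow, han, hpn, hfac]
    rw [one_mul, mul_inv, inv_inv, inv_inv]
  have hmaps : ∀ k : Fin n, MapsTo (fun t ↦ Φ (ζ ^ (k : ℕ) * a ω * p (t / ω)))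
      (closedBall 0 δ₀) (closedBall 0 δ) := fun k t ht ↦
    mem_closedBall_zero_iff.mpr <| (hΦn _ (hargr k t ht)).trans <|
      (mul_le_mul_of_nonneg_left (harg k t ht) K.2).trans hη2
  refine ⟨hmaps, fun k ↦ ?_, fun t ht k j hkj ↦ ?_, fun s hs t ht ↦ ⟨fun ⟨hs0, hst⟩ ↦ ?_, ?_⟩⟩
  · refine LipschitzOnWith.of_dist_le_mul fun t ht u hu ↦ ?_
    calc dist (Φ _) (Φ _) ≤ K * dist (ζ ^ (k : ℕ) * a ω * p (t / ω)) (ζ ^ (k : ℕ) * a ω * p (u / ω)) :=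
          hK.dist_le_mul _ (hargr k t ht) _ (hargr k u hu)
      _ = K * (‖a ω‖ * dist (p (t / ω)) (p (u / ω))) := by
          rw [dist_eq_norm, ← mul_sub, norm_mul, norm_mul, hζ1, one_mul, ← dist_eq_norm]
      _ ≤ K * (η * (K' * dist t u)) := by
          gcongr
          refine (hK'.dist_le_mul _ (hdiv t ht) _ (hdiv u hu)).trans ?_
          gcongr
          rw [dist_eq_norm, ← sub_div, norm_div, ← dist_eq_norm]
          exact div_le_self dist_nonneg hω1.le
      _ = K * (η * K') * dist t u := by ring
      _ ≤ _ := by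
          push_cast
          gcongr
  · have h1 := congrArg φ hkj
    simp only at h1
    rw [hri _ (hargr k t ht), hri _ (hargr j t ht)] at h1
    have h2 := mul_right_cancel₀ ha0 (mul_right_cancel₀ (hp0 t ht) h1)
    exact Fin.ext (hζ.pow_inj k.2 j.2 h2)
  -- Two numbers with equal `n`-th powers differ by a power of `ζ`, which names the branch.
  · have h1 : φ s ^ n = (a ω * p (t / ω)) ^ n := by
      have h2 := hpow 0 t
      rw [pow_zero, one_mul] at h2
      rw [← inv_inj, h2, ← hst, hφf s (closedBall_subset_closedBall hδ₀δ₁ hs) hs0]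
    have hap : a ω * p (t / ω) ≠ 0 := mul_ne_zero ha0 (hp0 t ht)
    have : NeZero n := ⟨hn⟩
    obtain ⟨k, hk, hkk⟩ := hζ.eq_pow_of_pow_eq_one (ξ := φ s / (a ω * p (t / ω)))
      (by rw [div_pow, h1, div_self (pow_ne_zero n hap)])
    refine ⟨⟨k, hk⟩, ?_⟩
    simp only
    rw [mul_assoc, hkk, div_mul_cancel₀ _ hap, hl s (closedBall_subset_closedBall hδ₀δ₁ hs)]
  · rintro ⟨k, rfl⟩
    have h1 := hri _ (hargr k t ht)
    have hs0 : Φ (ζ ^ (k : ℕ) * a ω * p (t / ω)) ≠ 0 := fun H ↦ by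
      rw [H, hφ0] at h1
      have h2 := hpow k t
      rw [← h1, zero_pow hn, inv_zero] at h2
      exact hne t ht h2.symm
    exact ⟨hs0, by rw [hφf _ (closedBall_subset_closedBall hδ₀δ₁ hs) hs0, h1, hpow]⟩

/-! ### Periodicity and the poles of `℘²` and `℘'`. -/

open Metric Set Filter Topology in
/-- A continuous periodic function on the complement of the lattice is bounded away from the
lattice. -/
theorem PeriodPair.exists_mem_lattice_of_lt_norm (L : PeriodPair) {f : ℂ → ℂ}
    (hc : ContinuousOn f (L.lattice : Set ℂ)ᶜ) (hp : ∀ (z : ℂ) (l : L.lattice), f (z - l) = f z)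
    {δ : ℝ} (hδ : 0 < δ) :
    ∃ M : ℝ, ∀ z, M < ‖f z‖ → ∃ l : L.lattice, ‖z - l‖ ≤ δ := by
  set B : ℝ := ∑ i, ‖L.basis i‖
  -- The ball of radius `B` contains the fundamental parallelogram, so every point at distance at
  -- least `δ` from the lattice has a translate in this compact set.
  set K : Set ℂ := closedBall 0 B ∩ ⋂ l : L.lattice, {z : ℂ | δ ≤ ‖z - l‖} with hK
  have hKc : IsCompact K := (isCompact_closedBall _ _).inter_right <|
    isClosed_iInter fun l ↦ isClosed_le continuous_const (by fun_prop)
  have hKs : K ⊆ (L.lattice : Set ℂ)ᶜ := fun z hz hzl ↦ by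
    have := mem_iInter.mp hz.2 ⟨z, hzl⟩
    simp only [mem_ofPred_eq, sub_self, norm_zero] at this
    linarith
  obtain ⟨M, hM⟩ := hKc.exists_bound_of_continuousOn (hc.mono hKs)
  refine ⟨M, fun z hz ↦ ?_⟩
  by_contra! H
  let l₀ : L.lattice := ⟨ZSpan.floor L.basis z, by
    rw [L.lattice_eq_span_range_basis]; exact (ZSpan.floor L.basis z).2⟩
  have hmem : z - l₀ ∈ K := by
    refine ⟨mem_closedBall_zero_iff.mpr (ZSpan.norm_fract_le L.basis z),
      mem_iInter.mpr fun l ↦ ?_⟩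
    have := (H (l₀ + l)).le
    simpa [sub_sub] using this
  have := hM _ hmem
  rw [hp] at this
  linarith

open Metric Filter in
/-- Nonzero periods are bounded away from `0`. -/
theorem PeriodPair.exists_forall_mem_lattice_norm_lt_imp_eq_zero (L : PeriodPair) :
    ∃ ε : ℝ, 0 < ε ∧ ∀ l ∈ L.lattice, ‖l‖ < ε → l = 0 := by
  obtain ⟨ε, hε, h⟩ := nhds_basis_ball.mem_iff.mp (L.compl_lattice_sdiff_singleton_mem_nhds 0)
  refine ⟨ε, hε, fun l hl hlε ↦ ?_⟩
  by_contra hl0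
  exact h (mem_ball_zero_iff.mpr hlε) ⟨hl, hl0⟩

open Metric Set Filter Topology in
theorem PeriodPair.exists_poleBranches_weierstrassP_sq (L : PeriodPair) :
    ∃ (T : ℂ → Fin 4 → ℂ → ℂ) (δ₀ : ℝ), 0 < δ₀ ∧ ∀ δ, 0 < δ → δ ≤ δ₀ → ∃ R : ℝ,
      ∀ ω : ℂ, R < ‖ω‖ → PoleBranches (fun z ↦ L.weierstrassP z ^ 2) (T ω) ω δ₀ δ := by
  refine exists_poleBranches (h := fun s ↦ (s ^ 2 * L.weierstrassPExcept 0 s + 1) ^ 2)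
    (by norm_num) (by fun_prop) (by simp) (.of_forall fun s hs ↦ ?_)
  have := L.weierstrassPExcept_add 0 s
  simp only [ZeroMemClass.coe_zero, sub_zero] at this
  rw [← this]
  field_simp
  simp

open Metric Set Filter Topology in
theorem PeriodPair.exists_poleBranches_derivWeierstrassP (L : PeriodPair) :
    ∃ (T : ℂ → Fin 3 → ℂ → ℂ) (δ₀ : ℝ), 0 < δ₀ ∧ ∀ δ, 0 < δ → δ ≤ δ₀ → ∃ R : ℝ,
      ∀ ω : ℂ, R < ‖ω‖ → PoleBranches L.derivWeierstrassP (T ω) ω δ₀ δ := by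
  refine exists_poleBranches (h := fun s ↦ s ^ 3 * L.derivWeierstrassPExcept 0 s - 2)
    (by norm_num) (by fun_prop) (by simp) (.of_forall fun s hs ↦ ?_)
  have := L.derivWeierstrassPExcept_sub 0 s
  simp only [ZeroMemClass.coe_zero, sub_zero] at this
  rw [← this]
  field_simp

/-! ### Pairs exchanged by two contractions. -/

open Metric Set in
/-- Two half-contractions of a ball have a unique pair of points that they exchange. -/
theorem exists_exchanged_pair {f g : ℂ → ℂ} {δ : ℝ} (hδ : 0 ≤ δ)
    (hf : MapsTo f (closedBall 0 δ) (closedBall 0 δ))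
    (hg : MapsTo g (closedBall 0 δ) (closedBall 0 δ))
    (hfl : LipschitzOnWith (1 / 2) f (closedBall 0 δ))
    (hgl : LipschitzOnWith (1 / 2) g (closedBall 0 δ)) :
    ∃ s ∈ closedBall (0 : ℂ) δ, ∃ t ∈ closedBall (0 : ℂ) δ, s = f t ∧ t = g s := by
  have hm : MapsTo (f ∘ g) (closedBall 0 δ) (closedBall 0 δ) := hf.comp hg
  have hc : ContractingWith (1 / 2 * (1 / 2)) (hm.restrict _ _ _) :=
    ⟨by rw [← NNReal.coe_lt_coe]; norm_num, (hfl.comp hgl hg).mapsToRestrict hm⟩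
  obtain ⟨s, hs, hfix, -⟩ := hc.exists_fixedPoint' isClosed_closedBall.isComplete hm
    (mem_closedBall_self hδ) (edist_ne_top _ _)
  exact ⟨s, hs, g s, hg hs, hfix.symm, rfl⟩

-- Each of the two distances is at most half the other, so both vanish. This identifies a given
-- solution with the constructed one.
open Metric Set in
theorem exchanged_pair_unique {f g : ℂ → ℂ} {D : Set ℂ}
    (hfl : LipschitzOnWith (1 / 2) f D) (hgl : LipschitzOnWith (1 / 2) g D)
    {s t s' t' : ℂ} (hs : s ∈ D) (ht : t ∈ D) (hs' : s' ∈ D) (ht' : t' ∈ D)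
    (h1 : s = f t) (h2 : t = g s) (h1' : s' = f t') (h2' : t' = g s') : s = s' := by
  have e1 := hfl.dist_le_mul t ht t' ht'
  have e2 := hgl.dist_le_mul s hs s' hs'
  rw [← h1, ← h1'] at e1
  rw [← h2, ← h2'] at e2
  push_cast at e1 e2
  have := dist_nonneg (x := s) (y := s')
  exact dist_le_zero.mp (by linarith)

theorem PeriodPair.infinite_largePeriodPairs (L : PeriodPair) (R : ℝ) :
    (largePeriodPairs L R).Infinite := by
  have h0 : L.ω₁ ≠ 0 := L.indep.ne_zero 0
  obtain ⟨N, hN⟩ := exists_nat_gt (R / ‖L.ω₁‖)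
  rw [div_lt_iff₀ (norm_pos_iff.mpr h0)] at hN
  let l : L.lattice := ⟨L.ω₁, L.ω₁_mem_lattice⟩
  refine Set.infinite_of_injective_forall_mem (f := fun n : ℕ ↦ ((N + n) • l, (N + n) • l))
    (fun m n hmn ↦ ?_) fun n ↦ ?_
  · have h1 := congrArg (fun x : L.lattice × L.lattice ↦ (x.1 : ℂ)) hmn
    simpa [l, h0] using h1
  · have : R < ‖(((N + n) • l : L.lattice) : ℂ)‖ := by
      have e : (((N + n) • l : L.lattice) : ℂ) = ((N + n : ℕ) : ℂ) * L.ω₁ := by simp [l]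
      rw [e, norm_mul, Complex.norm_natCast]
      refine hN.trans_le ?_
      gcongr
      exact Nat.le_add_right N n
    exact ⟨this, this⟩

/-! ### The twelve families. -/

open Metric Set in
theorem mainTheorem6 (L : PeriodPair) :
    (∃ z : ℂ, IsWeierstrassSolution L z) ∧
    ∃ (R : ℝ) (S : Fin 12 → L.lattice × L.lattice → ℂ),
      (∀ i, ∀ ω ∈ largePeriodPairs L R, IsWeierstrassSolution L (S i ω)) ∧
      (∀ i, (S i '' largePeriodPairs L R).Infinite) ∧
      (∀ i j, ∀ ω ∈ largePeriodPairs L R, ∀ η ∈ largePeriodPairs L R,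
        S i ω = S j η → i = j ∧ ω = η) ∧
      (∀ ε : ℝ, 0 < ε → ∃ R₁ : ℝ, R ≤ R₁ ∧ ∀ i, ∀ ω ∈ largePeriodPairs L R₁,
        ‖S i ω - ω.1‖ < ε ∧ ‖L.weierstrassP (S i ω) ^ 2 - ω.2‖ < ε) ∧
      (∃ R₂ : ℝ, ∀ z : ℂ, IsWeierstrassSolution L z → R₂ < ‖z‖ →
        R₂ < ‖L.weierstrassP z ^ 2‖ →
          ∃ i, ∃ ω ∈ largePeriodPairs L R, z = S i ω) := by
  obtain ⟨T, δT, hδT, hT⟩ := L.exists_poleBranches_weierstrassP_sq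
  obtain ⟨U, δU, hδU, hU⟩ := L.exists_poleBranches_derivWeierstrassP
  obtain ⟨ε₀, hε₀, hL0⟩ := L.exists_forall_mem_lattice_norm_lt_imp_eq_zero
  -- With `ε₀ / 3`, discs of radius `D` about distinct periods are disjoint, since `2 * D < ε₀`.
  set D : ℝ := min (min δT δU) (ε₀ / 3) with hD
  have hD0 : 0 < D := by positivity
  have hDT : D ≤ δT := (min_le_left _ _).trans (min_le_left _ _)
  have hDU : D ≤ δU := (min_le_left _ _).trans (min_le_right _ _)
  have hDε : D ≤ ε₀ / 3 := min_le_right _ _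
  replace hT : ∀ δ, 0 < δ → δ ≤ D → ∃ R : ℝ, ∀ ω : ℂ, R < ‖ω‖ →
      PoleBranches (fun z ↦ L.weierstrassP z ^ 2) (T ω) ω D δ := fun δ h1 h2 ↦
    (hT δ h1 (h2.trans hDT)).imp fun R h ω hω ↦ (h ω hω).mono hDT
  replace hU : ∀ δ, 0 < δ → δ ≤ D → ∃ R : ℝ, ∀ ω : ℂ, R < ‖ω‖ →
      PoleBranches L.derivWeierstrassP (U ω) ω D δ := fun δ h1 h2 ↦
    (hU δ h1 (h2.trans hDU)).imp fun R h ω hω ↦ (h ω hω).mono hDU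
  obtain ⟨RT, hRT⟩ := hT D hD0 le_rfl
  obtain ⟨RU, hRU⟩ := hU D hD0 le_rfl
  have hlat : ∀ l ∈ L.lattice, ∀ s ∈ closedBall (0 : ℂ) D, l + s ∈ L.lattice → s = 0 :=
    fun l hl s hs hls ↦ hL0 s ((L.lattice.add_mem_iff_right hl).mp hls)
      ((mem_closedBall_zero_iff.mp hs).trans_lt (by linarith))
  have hsep : ∀ l l' : L.lattice, ∀ s ∈ closedBall (0 : ℂ) D, ∀ s' ∈ closedBall (0 : ℂ) D,
      (l : ℂ) + s = l' + s' → l = l' ∧ s = s' := fun l l' s hs s' hs' h ↦ by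
    have h1 : (l : ℂ) - l' = s' - s := by linear_combination h
    have h2 : ((l : ℂ) - l') = 0 := hL0 _ (sub_mem l.2 l'.2) <| by
      rw [h1]
      rw [mem_closedBall_zero_iff] at hs hs'
      exact (norm_sub_le _ _).trans_lt (by linarith)
    exact ⟨Subtype.ext (sub_eq_zero.mp h2), (sub_eq_zero.mp (h1.symm.trans h2)).symm⟩
  have hPper : ∀ (l : L.lattice) s, L.weierstrassP (l + s) = L.weierstrassP s := fun l s ↦ by
    rw [add_comm, L.weierstrassP_add_coe]
  have hP'per : ∀ (l : L.lattice) s, L.derivWeierstrassP (l + s) = L.derivWeierstrassP s :=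
    fun l s ↦ by rw [add_comm, L.derivWeierstrassP_add_coe]
  set R := max RT RU with hR
  -- The index in `Fin 12` encodes a branch of `℘²` over `ω.2` and a branch of `℘'` over `ω.1`.
  have hpair : ∀ (i : Fin 12) (ω : L.lattice × L.lattice), ω ∈ largePeriodPairs L R →
      ∃ p : ℂ × ℂ, p.1 ∈ closedBall (0 : ℂ) D ∧ p.2 ∈ closedBall (0 : ℂ) D ∧
        p.1 = T ω.2 (finProdFinEquiv (m := 4) (n := 3).symm i).1 p.2 ∧
        p.2 = U ω.1 (finProdFinEquiv (m := 4) (n := 3).symm i).2 p.1 := fun i ω hω ↦ by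
    have h1 := hRT ω.2 ((le_max_left _ _).trans_lt hω.2)
    have h2 := hRU ω.1 ((le_max_right _ _).trans_lt hω.1)
    obtain ⟨s, hs, t, ht, hst, hts⟩ := exists_exchanged_pair hD0.le (h1.mapsTo _) (h2.mapsTo _)
      (h1.lipschitz _) (h2.lipschitz _)
    exact ⟨(s, t), hs, ht, hst, hts⟩
  choose! p hp1 hp2 hpT hpU using hpair
  have hsolT : ∀ i, ∀ ω ∈ largePeriodPairs L R,
      (p i ω).1 ≠ 0 ∧ L.weierstrassP (p i ω).1 ^ 2 = ω.2 + (p i ω).2 := fun i ω hω ↦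
    ((hRT ω.2 ((le_max_left _ _).trans_lt hω.2)).solves _ (hp1 i ω hω) _ (hp2 i ω hω)).mpr
      ⟨_, hpT i ω hω⟩
  have hsolU : ∀ i, ∀ ω ∈ largePeriodPairs L R,
      (p i ω).2 ≠ 0 ∧ L.derivWeierstrassP (p i ω).2 = ω.1 + (p i ω).1 := fun i ω hω ↦
    ((hRU ω.1 ((le_max_right _ _).trans_lt hω.1)).solves _ (hp2 i ω hω) _ (hp1 i ω hω)).mpr
      ⟨_, hpU i ω hω⟩
  set S : Fin 12 → L.lattice × L.lattice → ℂ := fun i ω ↦ ω.1 + (p i ω).1 with hS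
  have hPS : ∀ i, ∀ ω ∈ largePeriodPairs L R, L.weierstrassP (S i ω) ^ 2 = ω.2 + (p i ω).2 :=
    fun i ω hω ↦ by rw [hS, hPper, (hsolT i ω hω).2]
  have hsol : ∀ i, ∀ ω ∈ largePeriodPairs L R, IsWeierstrassSolution L (S i ω) := fun i ω hω ↦ by
    refine ⟨fun h ↦ (hsolT i ω hω).1 (hlat _ ω.1.2 _ (hp1 i ω hω) h), ?_, ?_⟩
    · rw [hPS i ω hω]
      exact fun h ↦ (hsolU i ω hω).1 (hlat _ ω.2.2 _ (hp2 i ω hω) h)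
    · rw [hPS i ω hω, hP'per, (hsolU i ω hω).2]
  have hinj : ∀ i j, ∀ ω ∈ largePeriodPairs L R, ∀ η ∈ largePeriodPairs L R,
      S i ω = S j η → i = j ∧ ω = η := fun i j ω hω η hη h ↦ by
    obtain ⟨e1, e2⟩ := hsep _ _ _ (hp1 i ω hω) _ (hp1 j η hη) h
    have h' := congrArg (fun z ↦ L.weierstrassP z ^ 2) h
    simp only [hPS i ω hω, hPS j η hη] at h'
    obtain ⟨e3, e4⟩ := hsep _ _ _ (hp2 i ω hω) _ (hp2 j η hη) h'
    obtain rfl : ω = η := Prod.ext e1 e3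
    refine ⟨?_, rfl⟩
    -- Both indices now give the same `s` and `t`, and distinct branches never agree at a point.
    have hTi := hpT i ω hω
    have hUi := hpU i ω hω
    rw [e4, e2, hpT j ω hω] at hTi
    rw [e4, e2, hpU j ω hω] at hUi
    have k1 := (hRT ω.2 ((le_max_left _ _).trans_lt hω.2)).injective _ (hp2 j ω hω) hTi
    have k2 := (hRU ω.1 ((le_max_right _ _).trans_lt hω.1)).injective _ (hp1 j ω hω) hUi
    exact finProdFinEquiv.symm.injective (Prod.ext k1.symm k2.symm)
  refine ⟨?_, R, S, hsol, fun i ↦ ?_, hinj, fun ε hε ↦ ?_, ?_⟩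
  · obtain ⟨ω, hω⟩ := (L.infinite_largePeriodPairs R).nonempty
    exact ⟨_, hsol 0 ω hω⟩
  · exact (L.infinite_largePeriodPairs R).image fun ω hω η hη h ↦ (hinj i i ω hω η hη h).2
  · have hδ0 : 0 < min D (ε / 2) := by positivity
    obtain ⟨R1, hR1⟩ := hT _ hδ0 (min_le_left _ _)
    obtain ⟨R2, hR2⟩ := hU _ hδ0 (min_le_left _ _)
    refine ⟨max R (max R1 R2), le_max_left _ _, fun i ω hω ↦ ?_⟩
    have hωR : ω ∈ largePeriodPairs L R :=
      ⟨(le_max_left _ _).trans_lt hω.1, (le_max_left _ _).trans_lt hω.2⟩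
    have hsmall : min D (ε / 2) < ε := (min_le_right _ _).trans_lt (by linarith)
    have m1 := (hR1 ω.2 (((le_max_left _ _).trans (le_max_right _ _)).trans_lt hω.2)).mapsTo
      (finProdFinEquiv (m := 4) (n := 3).symm i).1 (hp2 i ω hωR)
    have m2 := (hR2 ω.1 (((le_max_right _ _).trans (le_max_right _ _)).trans_lt hω.1)).mapsTo
      (finProdFinEquiv (m := 4) (n := 3).symm i).2 (hp1 i ω hωR)
    rw [← hpT i ω hωR, mem_closedBall_zero_iff] at m1
    rw [← hpU i ω hωR, mem_closedBall_zero_iff] at m2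
    rw [hPS i ω hωR, hS]
    simpa using ⟨m1.trans_lt hsmall, m2.trans_lt hsmall⟩
  · obtain ⟨M1, hM1⟩ := L.exists_mem_lattice_of_lt_norm
      L.differentiableOn_weierstrassP.continuousOn L.weierstrassP_sub_coe hD0
    obtain ⟨M2, hM2⟩ := L.exists_mem_lattice_of_lt_norm
      L.differentiableOn_derivWeierstrassP.continuousOn L.derivWeierstrassP_sub_coe hD0
    -- `R + D` makes the periods near `z` and `℘(z)²` exceed `R`; `|M1| ^ 2` makes `℘(z)` large, and
    -- `M2` applies because `℘'(℘(z)²) = z`.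
    refine ⟨max (R + D) (max (|M1| ^ 2) M2), fun z hz hz1 hz2 ↦ ?_⟩
    obtain ⟨hzL, hwL, hzw⟩ := hz
    obtain ⟨l, hl⟩ := hM1 z <| by
      rw [norm_pow] at hz2
      exact (le_abs_self _).trans_lt (lt_of_pow_lt_pow_left₀ 2 (norm_nonneg _)
        (((le_max_left _ _).trans (le_max_right _ _)).trans_lt hz2))
    obtain ⟨m, hm⟩ := hM2 (L.weierstrassP z ^ 2) <| by
      rw [hzw]
      exact ((le_max_right _ _).trans (le_max_right _ _)).trans_lt hz1
    have hbig : ∀ (x : ℂ) (l : L.lattice), ‖x - l‖ ≤ D → R + D < ‖x‖ → R < ‖(l : ℂ)‖ :=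
      fun x l h1 h2 ↦ by
        have := norm_sub_norm_le x l
        linarith
    have hω : (l, m) ∈ largePeriodPairs L R :=
      ⟨hbig z l hl ((le_max_left _ _).trans_lt hz1), hbig _ m hm ((le_max_left _ _).trans_lt hz2)⟩
    have hs : z - l ∈ closedBall (0 : ℂ) D := mem_closedBall_zero_iff.mpr hl
    have ht : L.weierstrassP z ^ 2 - m ∈ closedBall (0 : ℂ) D := mem_closedBall_zero_iff.mpr hm
    have hT' := hRT m ((le_max_left _ _).trans_lt hω.2)
    have hU' := hRU l ((le_max_right _ _).trans_lt hω.1)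
    obtain ⟨k, hk⟩ := (hT'.solves _ hs _ ht).mp
      ⟨fun h ↦ hzL (sub_eq_zero.mp h ▸ l.2), by simp⟩
    obtain ⟨j, hj⟩ := (hU'.solves _ ht _ hs).mp
      ⟨fun h ↦ hwL (sub_eq_zero.mp h ▸ m.2), by simp [hzw]⟩
    refine ⟨finProdFinEquiv (m := 4) (n := 3) (k, j), (l, m), hω, ?_⟩
    have q1 := hpT (finProdFinEquiv (m := 4) (n := 3) (k, j)) _ hω
    have q2 := hpU (finProdFinEquiv (m := 4) (n := 3) (k, j)) _ hω
    simp only [Equiv.symm_apply_apply] at q1 q2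
    have := exchanged_pair_unique (hT'.lipschitz k) (hU'.lipschitz j) hs ht (hp1 _ _ hω)
      (hp2 _ _ hω) hk hj q1 q2
    rw [hS]
    simp only
    rw [← this, add_sub_cancel]
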